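/- Theorem 2.3 (Convergence rate). Let $E$ be a Polish space with its Borel $\sigma$-field and let $d$ be a metric on $E$ that is lower semicontinuous on $E^2$ (it need not generate the topology of $E$). Put $d_{L^1}(x,y)=\sum_{i=1}^N d(x^i,y^i)$ on $E^N$, and for probability measures let $W_{1,d}(\nu_1,\nu_2)=\inf_\pi\iint d\,d\pi\in[0,\infty]$, the infimum over all couplings $\pi$ of $\nu_1,\nu_2$; $W_{1,d_{L^1}}$ is defined in the same way on $E^N$. Let $\mu$ be a probability measure on $E^N$ with $\int d(y^i,x_0^i)\,\mu(dy)<\infty$ for all $i$ and some $x_0\in E^N$. For $i=1,\dots,N$ let $\mu_i(\cdot|x)$ be a given regular conditional distribution under $\mu$ of $x^i$ knowing $(x^j)_{j\ne i}$ (it depends on $x$ only through $(x^j)_{j\neq i}$). Assume that for all $i$ and $x$ the measure $\mu_i(\cdot|x)$ has a finite first $d$-moment, and that $x\mapsto\mu_i(\cdot|x)$ is Lipschitz from $(E^N,d_{L^1})$ to $W_{1,d}$. Let $\bar\mu_i(dy|x)=\big(\prod_{j\ne i}\delta_{x^j}(dy^j)\big)\otimes\mu_i(dy^i|x)$, and let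 $P=\bar\mu_1\cdots\bar\mu_N$ be the transition kernel of the Gibbs sampler (coordinates $1,\dots,N$ are updated successively). Let $$c_{ij}=\sup_{x=y\text{ off }j,\ x^j\ne y^j}\frac{W_{1,d}(\mu_i(\cdot|x),\mu_i(\cdot|y))}{d(x^j,y^j)},\qquad \delta_i(f)=\sup_{x=y\text{ off }i,\ x^i\ne y^i}\frac{|f(x)-f(y)|}{d(x^i,y^i)},$$ and assume Dobrushin's uniqueness condition (H1): $r:=\|C\|_\infty=\max_i\sum_j c_{ij}<1$. In the bounds below $0\cdot\infty=0$. (a) Let $f:E^N\to\mathbb R$ be Borel measurable and Lipschitz for $d_{L^1}$, and let $k\ge1$. If a probability measure $\nu$ on $E^N$ has a finite first $d_{L^1}$-moment, then $f$ is integrable for $\nu P^k$. For all probability measures $\nu_1,\nu_2$ on $E^N$ such that $f$ is integrable for $\nu_1P^k$ and $\nu_2P^k$, and every coupling $(Z_0(1),Z_0(2))$ of $(\nu_1,\nu_2)$, $$|\nu_1P^kf-\nu_2P^kf|\le r^k\,\max_{1\le i\le N}\mathbb E\,d(Z_0^i(1),Z_0^i(2))\,\sum_{i=1}^N\delta_i(f).$$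 (b) For every probability measure $\nu$ on $E^N$, every coupling $(Z_0(1),Z_0(2))$ of $(\nu,\mu)$ and every $k\ge1$, $$W_{1,d_{L^1}}(\nu P^k,\mu)\le N r^k\max_{1\le i\le N}\mathbb E\,d(Z_0^i(1),Z_0^i(2)).$$ Consequently $\mu$ is invariant for $P$ and is its only invariant probability measure, and for every $x\in E^N$ the quantity $\max_i\int d(x^i,y^i)\,\mu(dy)$ is finite and $W_{1,d_{L^1}}(P^k(x,\cdot),\mu)\le N r^k\max_i\int d(x^i,y^i)\,\mu(dy)$ for all $k\ge1$. -/

import Mathlib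

open MeasureTheory ProbabilityTheory
open scoped ENNReal NNReal

namespace GibbsSampling

/-- `d` is a (finite, real valued) metric on `α`. It is not tied to any topology on `α`. -/
structure IsMetric {α : Type*} (d : α → α → ℝ) : Prop where
  self_eq_zero : ∀ x, d x x = 0
  eq_of_eq_zero : ∀ x y, d x y = 0 → x = y
  symm : ∀ x y, d x y = d y x
  triangle : ∀ x y z, d x z ≤ d x y + d y z

/-- The `L¹`-metric on the product space `E ^ N` built from `d`. -/
def dL1 {E : Type*} {N : ℕ} (d : E → E → ℝ) (x y : Fin N → E) : ℝ :=
  ∑ i, d (x i) (y i)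

/-- `π` is a coupling of `ν₁` and `ν₂`: its marginals are `ν₁` and `ν₂`. -/
def IsCoupling {α : Type*} [MeasurableSpace α] (π : Measure (α × α)) (ν₁ ν₂ : Measure α) :
    Prop :=
  π.map Prod.fst = ν₁ ∧ π.map Prod.snd = ν₂

/-- The `L¹`-Wasserstein distance `W_{1,d}`: the infimum over all couplings of the mean of `d`
(with values in `[0, ∞]`). -/
noncomputable def wasserstein {α : Type*} [MeasurableSpace α] (d : α → α → ℝ)
    (ν₁ ν₂ : Measure α) : ℝ≥0∞ :=
  ⨅ (π : Measure (α × α)) (_ : IsCoupling π ν₁ ν₂), ∫⁻ z, ENNReal.ofReal (d z.1 z.2) ∂π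

/-- `ν` has a finite first moment with respect to `d`, i.e. the probability measure `ν` belongs
to `M₁^d`. -/
def HasFiniteMoment {α : Type*} [MeasurableSpace α] (d : α → α → ℝ) (ν : Measure α) : Prop :=
  ∃ x₀, ∫⁻ x, ENNReal.ofReal (d x₀ x) ∂ν < ∞

/-- The configuration `(x^j)_{j ≠ i}` of all coordinates of `x` but the `i`-th. -/
def offCoord {E : Type*} {N : ℕ} (i : Fin N) (x : Fin N → E) : {j : Fin N // j ≠ i} → E :=
  fun j => x j

lemma measurable_offCoord {E : Type*} [MeasurableSpace E] {N : ℕ} (i : Fin N) :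
    Measurable (offCoord (E := E) i) :=
  measurable_pi_lambda _ fun j => measurable_pi_apply (j : Fin N)

/-- The configurations `x` and `y` differ at the coordinate `j` and only there. -/
def DiffersOnlyAt {E : Type*} {N : ℕ} (j : Fin N) (x y : Fin N → E) : Prop :=
  (∀ k, k ≠ j → x k = y k) ∧ x j ≠ y j

/-- The `d`-Dobrushin interdependence coefficient `c_{ij}` of the conditional distributions
`κ i = μ_i`. -/
noncomputable def dobrushinCoeff {E : Type*} [MeasurableSpace E] {N : ℕ} (d : E → E → ℝ)
    (κ : ∀ i : Fin N, Kernel ({j : Fin N // j ≠ i} → E) E) (i j : Fin N) : ℝ≥0∞ :=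
  ⨆ (x : Fin N → E) (y : Fin N → E) (_ : DiffersOnlyAt j x y),
    wasserstein d (κ i (offCoord i x)) (κ i (offCoord i y)) / ENNReal.ofReal (d (x j) (y j))

/-- `r = ‖C‖_∞ = max_i ∑_j c_{ij}`. -/
noncomputable def dobrushinNorm {E : Type*} [MeasurableSpace E] {N : ℕ} (d : E → E → ℝ)
    (κ : ∀ i : Fin N, Kernel ({j : Fin N // j ≠ i} → E) E) : ℝ≥0∞ :=
  ⨆ i, ∑ j, dobrushinCoeff d κ i j

/-- `δ_i(f)`, the Lipschitz coefficient of `f` with respect to the `i`-th coordinate. -/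
noncomputable def coordLip {E : Type*} {N : ℕ} (d : E → E → ℝ) (f : (Fin N → E) → ℝ)
    (i : Fin N) : ℝ≥0∞ :=
  ⨆ (x : Fin N → E) (y : Fin N → E) (_ : DiffersOnlyAt i x y),
    ENNReal.ofReal |f x - f y| / ENNReal.ofReal (d (x i) (y i))

/-- The one-coordinate update kernel `μ̄_i(dy | x)`: the coordinates `j ≠ i` are kept and the
`i`-th one is resampled from `κ i = μ_i` given the others (see `gibbsStep_apply`). -/
noncomputable def gibbsStep {E : Type*} [MeasurableSpace E] {N : ℕ}
    (κ : ∀ i : Fin N, Kernel ({j : Fin N // j ≠ i} → E) E) (i : Fin N) :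
    Kernel (Fin N → E) (Fin N → E) :=
  (Kernel.id ×ₖ (κ i).comap (offCoord i) (measurable_offCoord i)).map
    fun p => Function.update p.1 i p.2

lemma measurable_updateCoord {E : Type*} [MeasurableSpace E] {N : ℕ} (i : Fin N) :
    Measurable fun p : (Fin N → E) × E => Function.update p.1 i p.2 := by
  refine measurable_pi_lambda _ fun j => ?_
  by_cases h : j = i
  · subst h
    simpa using measurable_snd
  · simp only [Function.update_of_ne h]
    fun_prop

lemma gibbsStep_apply {E : Type*} [MeasurableSpace E] {N : ℕ}
    (κ : ∀ i : Fin N, Kernel ({j : Fin N // j ≠ i} → E) E) [∀ i, IsMarkovKernel (κ i)]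
    (i : Fin N) (x : Fin N → E) :
    gibbsStep κ i x = (κ i (offCoord i x)).map (Function.update x i) := by
  rw [gibbsStep, Kernel.map_apply _ (measurable_updateCoord i), Kernel.prod_apply,
    Kernel.id_apply, Kernel.comap_apply, Measure.dirac_prod,
    Measure.map_map (measurable_updateCoord i) (by fun_prop)]
  rfl

/-- The transition kernel `P = μ̄_1 ⋯ μ̄_N` of the Gibbs sampler: one sweep, in which the
coordinates are updated successively, from the first to the last. -/
noncomputable def gibbsKernel {E : Type*} [MeasurableSpace E] {N : ℕ}
    (κ : ∀ i : Fin N, Kernel ({j : Fin N // j ≠ i} → E) E) :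
    Kernel (Fin N → E) (Fin N → E) :=
  (List.finRange N).foldl (fun K i => gibbsStep κ i ∘ₖ K) Kernel.id

end GibbsSampling

open MeasureTheory ProbabilityTheory
open scoped ENNReal NNReal

namespace GibbsSampling

/-! Two copies of the Gibbs sampler are run with coupled updates. When coordinate `i` is resampled,
the two new values are drawn from a nearly optimal coupling of the two conditional laws. Moving from
one configuration to the other one coordinate at a time bounds the distance of these laws by `∑ j,
c_ij d(x^j, y^j)` (`wasserstein_offCoord_le`), so the mean distance at `i` becomes at most the
corresponding combination of the old mean distances (`exists_coupling_gibbsStep`). If all mean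
distances are at most `D`, the new one is at most `r D ≤ D`; after a full sweep each coordinate has
been updated and all are at most `r D` (`exists_coupling_sweep`). Iteration gives `r ^ k`. Then (a)
follows by summing coordinate Lipschitz bounds, and (b) by starting one copy from `μ`, which every
update preserves.

The delicate point is to choose the couplings measurably in the pair of configurations.
`exists_glued_coupling` avoids a selection theorem: a single coupling is used on each of countably
many cells on which the conditional laws are nearly constant, and a weak limit is taken. Tightness
comes from the marginals, and lower semicontinuity of `d` lets the cost bound pass to the limit.

Uniqueness needs more than (b), since another invariant law may have infinite moments. The bound
from deterministic starting points is averaged for the truncated metric `min d 1`, where dominated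
convergence applies (`eq_of_tendsto_wasserstein`). -/

open Filter Topology Set

/-! ### Countable approximation of points and open sets. -/

section Discretization

/-- A second countable space has a countable `π`-system of open sets which is a basis. -/
lemma exists_countable_isPiSystem_basis (E : Type*) [TopologicalSpace E]
    [SecondCountableTopology E] :
    ∃ S : Set (Set E), S.Countable ∧ S.Nonempty ∧ IsPiSystem S ∧ (∀ s ∈ S, IsOpen s) ∧
      ∀ u : Set E, IsOpen u → ∀ x ∈ u, ∃ s ∈ S, s ∈ 𝓝 x ∧ s ⊆ u := by
  obtain ⟨B, hBc, -, hB⟩ := TopologicalSpace.exists_countable_basis E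
  -- Finite intersections of basic open sets; the empty family gives the whole space, hence
  -- nonemptiness.
  refine ⟨(fun t : Set (Set E) => ⋂₀ t) '' {t | t.Finite ∧ t ⊆ B},
    (countable_ofPred_finite_subset hBc).image _,
    ⟨_, ∅, ⟨finite_empty, empty_subset _⟩, rfl⟩, ?_, ?_, ?_⟩
  · rintro _ ⟨s, ⟨hs, hsB⟩, rfl⟩ _ ⟨t, ⟨ht, htB⟩, rfl⟩ -
    exact ⟨s ∪ t, ⟨hs.union ht, union_subset hsB htB⟩, sInter_union s t⟩
  · rintro _ ⟨s, ⟨hs, hsB⟩, rfl⟩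
    exact hs.isOpen_sInter fun u hu => hB.isOpen (hsB hu)
  · intro u hu x hx
    obtain ⟨v, hv, hxv, hvu⟩ := hB.exists_subset_of_mem_open hx hu
    exact ⟨v, ⟨{v}, ⟨finite_singleton v, singleton_subset_iff.2 hv⟩, sInter_singleton v⟩,
      (hB.isOpen hv).mem_nhds hxv, hvu⟩

/-- Finitely many measurable functions are uniformly close to their values at a
representative chosen measurably among countably many points. -/
lemma exists_measurable_representative {Z J : Type*} [MeasurableSpace Z] [Nonempty Z] [Finite J]
    (f : ℕ → J → Z → ℝ) (hf : ∀ i j, Measurable (f i j)) (n : ℕ) :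
    ∃ (idx : Z → ℕ) (rep : ℕ → Z), Measurable idx ∧
      ∀ z, ∀ i ≤ n, ∀ j, |f i j (rep (idx z)) - f i j z| ≤ 1 / ((n : ℝ) + 1) := by
  -- Two points with the same integer vector `F` have values within `1 / (n + 1)`. There are
  -- countably many such cells, and `invFun` picks one point in each.
  let F : Z → (Fin (n + 1) × J → ℤ) := fun z i => ⌊((n : ℝ) + 1) * f i.1 i.2 z⌋
  have hF : Measurable F := measurable_pi_lambda _ fun i => ((hf i.1 i.2).const_mul _).floor
  obtain ⟨e, he⟩ := exists_injective_nat (Fin (n + 1) × J → ℤ)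
  refine ⟨fun z => e (F z), Function.invFun fun z => e (F z),
    (measurable_of_countable e).comp hF, fun z i hi j => ?_⟩
  have h1 : e (F (Function.invFun (fun z => e (F z)) (e (F z)))) = e (F z) :=
    Function.invFun_eq (f := fun z => e (F z)) ⟨z, rfl⟩
  have h3 := congrFun (he h1) (⟨i, Nat.lt_succ_of_le hi⟩, j)
  have h4 := (Int.abs_sub_lt_one_of_floor_eq_floor h3).le
  have hn : (0 : ℝ) < (n : ℝ) + 1 := by positivity
  rw [← mul_sub, abs_mul, abs_of_pos hn] at h4
  rwa [le_div_iff₀ hn, mul_comm]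

end Discretization

/-! ### Gluing couplings without measurable selection. -/

section Gluing

/-- Weak lower semicontinuity of the integral of a lower semicontinuous function. -/
lemma lintegral_le_liminf_of_lowerSemicontinuous {X : Type*} [TopologicalSpace X]
    [MeasurableSpace X] [OpensMeasurableSpace X] [HasOuterApproxClosed X]
    {c : X → ℝ} (hc : LowerSemicontinuous c) (hc0 : ∀ x, 0 ≤ c x) {ρ : ProbabilityMeasure X}
    {ρs : ℕ → ProbabilityMeasure X} (h : Tendsto ρs atTop (𝓝 ρ)) :
    ∫⁻ x, ENNReal.ofReal (c x) ∂(ρ : Measure X) ≤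
      atTop.liminf fun n => ∫⁻ x, ENNReal.ofReal (c x) ∂(ρs n : Measure X) := by
  -- Layer-cake formula: superlevel sets are open, so the portmanteau theorem applies at each level
  -- and Fatou's lemma integrates over levels.
  simp_rw [lintegral_eq_lintegral_meas_lt _ (Eventually.of_forall hc0) hc.measurable.aemeasurable]
  calc ∫⁻ t in Ioi (0 : ℝ), (ρ : Measure X) {x | t < c x}
      ≤ ∫⁻ t in Ioi (0 : ℝ), atTop.liminf fun n => (ρs n : Measure X) {x | t < c x} :=
        lintegral_mono fun t =>
          ProbabilityMeasure.le_liminf_measure_open_of_tendsto h (hc.isOpen_preimage t)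
    _ ≤ _ := lintegral_liminf_le fun n => Antitone.measurable fun s t hst =>
        measure_mono fun x hx => lt_of_le_of_lt hst hx

/-- If the kernels `κs n` converge to `κ` on a `π`-system which is a basis, then the joint laws
`π ⊗ₘ κs n` converge weakly to `π ⊗ₘ κ`. -/
lemma tendsto_compProd {Z E : Type*} [TopologicalSpace Z] [SecondCountableTopology Z]
    [MeasurableSpace Z] [BorelSpace Z] [TopologicalSpace E] [SecondCountableTopology E]
    [MeasurableSpace E] [BorelSpace E] (π : Measure Z) [IsProbabilityMeasure π]
    {S : Set (Set E)} (hS : IsPiSystem S) (hSo : ∀ s ∈ S, IsOpen s)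
    (hSb : ∀ u : Set E, IsOpen u → ∀ x ∈ u, ∃ s ∈ S, s ∈ 𝓝 x ∧ s ⊆ u)
    (κ : Kernel Z E) [IsMarkovKernel κ] (κs : ℕ → Kernel Z E) [∀ n, IsMarkovKernel (κs n)]
    (h : ∀ z, ∀ s ∈ S, Tendsto (fun n => κs n z s) atTop (𝓝 (κ z s))) :
    Tendsto (β := ProbabilityMeasure (Z × E)) (fun n => ⟨π ⊗ₘ κs n, inferInstance⟩) atTop
      (𝓝 ⟨π ⊗ₘ κ, inferInstance⟩) := by
  -- Arbitrary measurable sets are allowed in the first factor because the marginal on `Z` is `π`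
  -- for all the laws.
  have hpi : IsPiSystem (image2 (· ×ˢ ·) {s : Set Z | MeasurableSet s} S) :=
    MeasurableSpace.isPiSystem_measurableSet.prod hS
  refine hpi.tendsto_probabilityMeasure_of_tendsto_of_mem ?_ ?_ ?_
  · rintro _ ⟨s, hs, t, ht, rfl⟩
    exact hs.prod (hSo t ht).measurableSet
  · rintro u hu ⟨z, x⟩ hx
    obtain ⟨a, b, ha, hb, hza, hxb, hab⟩ := isOpen_prod_iff.1 hu z x hx
    obtain ⟨s, hs, hsx, hsb⟩ := hSb b hb x hxb
    exact ⟨a ×ˢ s, ⟨a, ha.measurableSet, s, hs, rfl⟩, prod_mem_nhds (ha.mem_nhds hza) hsx,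
      (prod_mono_right hsb).trans hab⟩
  · rintro _ ⟨s, hs, t, ht, rfl⟩
    have htm := (hSo t ht).measurableSet
    have hfin : (π ⊗ₘ κ) (s ×ˢ t) ≠ ∞ := measure_ne_top _ _
    refine (ENNReal.tendsto_toNNReal hfin).comp ?_
    change Tendsto (fun n => (π ⊗ₘ κs n) (s ×ˢ t)) atTop (𝓝 ((π ⊗ₘ κ) (s ×ˢ t)))
    simp only [Measure.compProd_apply_prod hs htm]
    refine tendsto_lintegral_of_dominated_convergence (fun _ => 1)
      (fun n => Kernel.measurable_coe _ htm) (fun n => ae_of_all _ fun z => prob_le_one) ?_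
      (ae_of_all _ fun z => h z t ht)
    simp

/-- The set of terms of a weakly convergent sequence of probability measures is tight. -/
lemma isTightMeasureSet_range_of_tendsto {X : Type*} [TopologicalSpace X] [PolishSpace X]
    [MeasurableSpace X] [BorelSpace X] {ρs : ℕ → ProbabilityMeasure X} {ρ : ProbabilityMeasure X}
    (h : Tendsto ρs atTop (𝓝 ρ)) :
    IsTightMeasureSet (range fun n => (ρs n : Measure X)) := by
  let := TopologicalSpace.upgradeIsCompletelyMetrizable X
  have hc : IsCompact (closure (range ρs)) :=
    h.isCompact_insert_range.closure_of_subset (subset_insert _ _)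
  refine (isTightMeasureSet_of_isCompact_closure hc).subset ?_
  rintro _ ⟨n, rfl⟩
  exact ⟨ρs n, ⟨n, rfl⟩, rfl⟩

variable {Z E : Type*} [TopologicalSpace Z] [PolishSpace Z] [MeasurableSpace Z] [BorelSpace Z]
  [TopologicalSpace E] [PolishSpace E] [MeasurableSpace E] [BorelSpace E]

/-- If the laws `κ₁ z` and `κ₂ z` can be coupled, for each `z`, at a cost of nearly `g z`, then
these couplings can be chosen simultaneously, up to a `π`-null set, with total cost `∫ g dπ`. -/
theorem exists_glued_coupling (π : Measure Z) [IsProbabilityMeasure π] (κ₁ κ₂ : Kernel Z E)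
    [IsMarkovKernel κ₁] [IsMarkovKernel κ₂] {c : E × E → ℝ} (hc : LowerSemicontinuous c)
    (hc0 : ∀ p, 0 ≤ c p) {g : Z → ℝ≥0} (hg : Measurable g)
    (h : ∀ z, ∀ ε : ℝ≥0, 0 < ε → ∃ q : Measure (E × E), IsCoupling q (κ₁ z) (κ₂ z) ∧
      ∫⁻ p, ENNReal.ofReal (c p) ∂q ≤ g z + ε) :
    ∃ ρ : Measure (Z × (E × E)), IsProbabilityMeasure ρ ∧
      ρ.map (fun p => (p.1, p.2.1)) = π ⊗ₘ κ₁ ∧ ρ.map (fun p => (p.1, p.2.2)) = π ⊗ₘ κ₂ ∧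
      ∫⁻ p, ENNReal.ofReal (c p.2) ∂ρ ≤ ∫⁻ z, g z ∂π := by
  have : Nonempty Z := nonempty_of_isProbabilityMeasure π
  obtain ⟨S, hSc, hSne, hS, hSo, hSb⟩ := exists_countable_isPiSystem_basis E
  obtain ⟨U, rfl⟩ := hSc.exists_eq_range hSne
  have hUm : ∀ i, MeasurableSet (U i) := fun i => (hSo _ ⟨i, rfl⟩).measurableSet
  -- An arbitrary choice, with no measurability in `z`; for each `n` it is used only at the
  -- countably many points `rep n k`.
  choose! q hq hqc using h
  let ε : ℕ → ℝ≥0 := fun n => 1 / ((n : ℝ≥0) + 1)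
  have hε : ∀ n, 0 < ε n := fun n => by positivity
  have hεlim : Tendsto (fun n => (ε n : ℝ)) atTop (𝓝 0) := by
    simpa [ε] using tendsto_one_div_add_atTop_nhds_zero_nat (𝕜 := ℝ)
  -- The three quantities kept nearly constant on cells: the cost bound and the masses of `U i`
  -- under both kernels.
  choose idx rep hidx hrep using exists_measurable_representative
    (fun i => ![fun z => (g z : ℝ), fun z => (κ₁ z).real (U i), fun z => (κ₂ z).real (U i)])
    (fun i j => by
      fin_cases j
      · exact hg.coe_nnreal_real
      · exact (Kernel.measurable_coe κ₁ (hUm i)).ennreal_toReal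
      · exact (Kernel.measurable_coe κ₂ (hUm i)).ennreal_toReal)
  let φ : ℕ → Z → Z := fun n z => rep n (idx n z)
  have hφ : ∀ n, Measurable (φ n) := fun n => (measurable_of_countable (rep n)).comp (hidx n)
  have hεr : ∀ n, (ε n : ℝ) = 1 / ((n : ℝ) + 1) := fun n => by simp [ε]
  have hφg : ∀ n z, g (φ n z) ≤ g z + ε n := fun n z => by
    have := (abs_le.1 (hrep n z 0 n.zero_le 0)).2
    rw [← NNReal.coe_le_coe, NNReal.coe_add, hεr]
    simp only [Matrix.cons_val_zero] at this
    linarith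
  have key : ∀ (κ : Kernel Z E) [IsMarkovKernel κ],
      (∀ n z, ∀ i ≤ n, |(κ (φ n z)).real (U i) - (κ z).real (U i)| ≤ ε n) →
      Tendsto (β := ProbabilityMeasure (Z × E))
        (fun n => ⟨π ⊗ₘ κ.comap (φ n) (hφ n), inferInstance⟩) atTop
        (𝓝 ⟨π ⊗ₘ κ, inferInstance⟩) := by
    intro κ _ hκ
    refine tendsto_compProd π hS hSo hSb κ _ ?_
    rintro z _ ⟨i, rfl⟩
    rw [← ENNReal.tendsto_toReal_iff (fun n => measure_ne_top _ _) (measure_ne_top _ _),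
      tendsto_iff_dist_tendsto_zero]
    refine squeeze_zero' (Eventually.of_forall fun _ => dist_nonneg) ?_ hεlim
    filter_upwards [eventually_ge_atTop i] with n hn
    exact hκ n z i hn
  have key₁ := key κ₁ fun n z i hi => by rw [hεr]; exact hrep n z i hi 1
  have key₂ := key κ₂ fun n z i hi => by rw [hεr]; exact hrep n z i hi 2
  -- Measurable because it factors through the countable index `idx n`.
  let K : ℕ → Kernel Z (E × E) := fun n =>
    (Kernel.ofFunOfCountable fun k => q (rep n k) (ε n)).comap (idx n) (hidx n)
  have hK : ∀ n z, K n z = q (φ n z) (ε n) := fun n z => rfl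
  have hKprob : ∀ n, IsMarkovKernel (K n) := fun n => ⟨fun z => by
    have h1 := (hq (φ n z) (ε n) (hε n)).1
    rw [hK]
    have : IsProbabilityMeasure ((q (φ n z) (ε n)).map Prod.fst) := by rw [h1]; infer_instance
    exact Measure.isProbabilityMeasure_of_map Prod.fst⟩
  let ρs : ℕ → ProbabilityMeasure (Z × (E × E)) := fun n => ⟨π ⊗ₘ K n, inferInstance⟩
  have hm₁ : Measurable fun p : Z × (E × E) => (p.1, p.2.1) := by fun_prop
  have hm₂ : Measurable fun p : Z × (E × E) => (p.1, p.2.2) := by fun_prop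
  have hρ₁ : ∀ n, (ρs n : Measure (Z × (E × E))).map (fun p => (p.1, p.2.1)) =
      π ⊗ₘ κ₁.comap (φ n) (hφ n) := fun n => by
    have : κ₁.comap (φ n) (hφ n) = (K n).map Prod.fst := by
      ext1 z
      rw [Kernel.map_apply _ measurable_fst, hK, (hq (φ n z) (ε n) (hε n)).1,
        Kernel.comap_apply]
    rw [this, Measure.compProd_map measurable_fst]
    rfl
  have hρ₂ : ∀ n, (ρs n : Measure (Z × (E × E))).map (fun p => (p.1, p.2.2)) =
      π ⊗ₘ κ₂.comap (φ n) (hφ n) := fun n => by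
    have : κ₂.comap (φ n) (hφ n) = (K n).map Prod.snd := by
      ext1 z
      rw [Kernel.map_apply _ measurable_snd, hK, (hq (φ n z) (ε n) (hε n)).2,
        Kernel.comap_apply]
    rw [this, Measure.compProd_map measurable_snd]
    rfl
  -- Each of the three coordinate marginals comes from a weakly convergent sequence, hence is tight;
  -- tight marginals make the joint laws tight.
  have htight : IsTightMeasureSet {((m : ProbabilityMeasure _) : Measure (Z × (E × E))) |
      m ∈ range ρs} := by
    have t₁ := isTightMeasureSet_range_of_tendsto key₁
    have t₂ := isTightMeasureSet_range_of_tendsto key₂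
    refine IsTightMeasureSet.prodMk ((t₁.map continuous_fst).subset ?_)
      (IsTightMeasureSet.prodMk ((t₁.map continuous_snd).subset ?_)
        ((t₂.map continuous_snd).subset ?_))
    · rintro _ ⟨_, ⟨_, ⟨n, rfl⟩, rfl⟩, rfl⟩
      refine ⟨_, ⟨n, rfl⟩, ?_⟩
      simp only [ProbabilityMeasure.coe_mk]
      rw [← hρ₁, Measure.map_map measurable_fst hm₁]
      rfl
    · rintro _ ⟨_, ⟨_, ⟨_, ⟨n, rfl⟩, rfl⟩, rfl⟩, rfl⟩
      refine ⟨_, ⟨n, rfl⟩, ?_⟩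
      simp only [ProbabilityMeasure.coe_mk]
      rw [← hρ₁, Measure.map_map measurable_snd hm₁, Measure.fst, Measure.snd,
        Measure.map_map measurable_fst measurable_snd]
      rfl
    · rintro _ ⟨_, ⟨_, ⟨_, ⟨n, rfl⟩, rfl⟩, rfl⟩, rfl⟩
      refine ⟨_, ⟨n, rfl⟩, ?_⟩
      simp only [ProbabilityMeasure.coe_mk]
      rw [← hρ₂, Measure.map_map measurable_snd hm₂, Measure.snd, Measure.snd,
        Measure.map_map measurable_snd measurable_snd]
      rfl
  obtain ⟨ρ, -, ψ, hψ, hlim⟩ := (isCompact_closure_of_isTightMeasureSet htight).isSeqCompact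
    fun n => subset_closure (mem_range_self n)
  refine ⟨ρ, inferInstance, ?_, ?_, ?_⟩
  · have h1 := ((ProbabilityMeasure.continuous_map (f := fun p : Z × (E × E) => (p.1, p.2.1))
      (by fun_prop)).tendsto ρ).comp hlim
    have e : ∀ n, (ρs n).map (f := fun p : Z × (E × E) => (p.1, p.2.1)) (by fun_prop) =
        (⟨π ⊗ₘ κ₁.comap (φ n) (hφ n), inferInstance⟩ : ProbabilityMeasure (Z × E)) :=
      fun n => Subtype.ext (hρ₁ n)
    have h2 := tendsto_nhds_unique (h1.congr fun n => e (ψ n)) (key₁.comp hψ.tendsto_atTop)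
    exact congrArg (fun m : ProbabilityMeasure (Z × E) => (m : Measure (Z × E))) h2
  · have h1 := ((ProbabilityMeasure.continuous_map (f := fun p : Z × (E × E) => (p.1, p.2.2))
      (by fun_prop)).tendsto ρ).comp hlim
    have e : ∀ n, (ρs n).map (f := fun p : Z × (E × E) => (p.1, p.2.2)) (by fun_prop) =
        (⟨π ⊗ₘ κ₂.comap (φ n) (hφ n), inferInstance⟩ : ProbabilityMeasure (Z × E)) :=
      fun n => Subtype.ext (hρ₂ n)
    have h2 := tendsto_nhds_unique (h1.congr fun n => e (ψ n)) (key₂.comp hψ.tendsto_atTop)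
    exact congrArg (fun m : ProbabilityMeasure (Z × E) => (m : Measure (Z × E))) h2
  · have hcm : Measurable fun p : Z × (E × E) => ENNReal.ofReal (c p.2) :=
      (hc.measurable.comp measurable_snd).ennreal_ofReal
    -- One `ε n` pays for the near optimality of `q`, the other for replacing `g (φ n z)` by `g z`.
    have hcost : ∀ n, ∫⁻ p, ENNReal.ofReal (c p.2) ∂(ρs n : Measure (Z × (E × E))) ≤
        ∫⁻ z, g z ∂π + 2 * ε n := fun n => calc
      _ = ∫⁻ z, ∫⁻ p, ENNReal.ofReal (c p) ∂(K n z) ∂π := Measure.lintegral_compProd hcm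
      _ ≤ ∫⁻ z, (g z + 2 * ε n : ℝ≥0∞) ∂π := lintegral_mono fun z => by
        refine (hqc (φ n z) (ε n) (hε n)).trans ?_
        have := hφg n z
        norm_cast
        linarith
      _ = _ := by rw [lintegral_add_right _ measurable_const]; simp
    have hlim0 : Tendsto (fun n => ∫⁻ z, (g z : ℝ≥0∞) ∂π + 2 * (ε (ψ n) : ℝ≥0∞)) atTop
        (𝓝 (∫⁻ z, (g z : ℝ≥0∞) ∂π)) := by
      have h0 : Tendsto (fun n => (ε (ψ n) : ℝ≥0∞)) atTop (𝓝 0) := by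
        have := (NNReal.tendsto_coe (x := 0)).1 (by simpa using hεlim)
        exact_mod_cast (ENNReal.tendsto_coe.2 this).comp hψ.tendsto_atTop
      simpa using tendsto_const_nhds.add (ENNReal.Tendsto.const_mul h0 (Or.inr (by simp)))
    calc _ ≤ atTop.liminf fun n =>
          ∫⁻ p, ENNReal.ofReal (c p.2) ∂(ρs (ψ n) : Measure (Z × (E × E))) :=
        lintegral_le_liminf_of_lowerSemicontinuous (c := fun p : Z × (E × E) => c p.2)
          (LowerSemicontinuous.comp hc continuous_snd) (fun p => hc0 p.2) hlim
      _ ≤ atTop.liminf fun n => ∫⁻ z, (g z : ℝ≥0∞) ∂π + 2 * (ε (ψ n) : ℝ≥0∞) :=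
        liminf_le_liminf (Eventually.of_forall fun n => hcost (ψ n))
      _ = _ := hlim0.liminf_eq

end Gluing

/-! ### Coordinatewise bounds from one-coordinate Lipschitz coefficients. -/

section Metric

variable {α : Type*} {d : α → α → ℝ}

lemma IsMetric.nonneg (hd : IsMetric d) (x y : α) : 0 ≤ d x y := by
  have h1 := hd.triangle x y x
  rw [hd.self_eq_zero, hd.symm y x] at h1
  linarith

lemma IsMetric.pos (hd : IsMetric d) {x y : α} (h : x ≠ y) : 0 < d x y :=
  lt_of_le_of_ne (hd.nonneg x y) fun h0 => h (hd.eq_of_eq_zero x y h0.symm)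

lemma IsMetric.ofReal_triangle (hd : IsMetric d) (x y z : α) :
    ENNReal.ofReal (d x z) ≤ ENNReal.ofReal (d x y) + ENNReal.ofReal (d y z) := by
  rw [← ENNReal.ofReal_add (hd.nonneg _ _) (hd.nonneg _ _)]
  exact ENNReal.ofReal_le_ofReal (hd.triangle x y z)

lemma IsMetric.dL1 {N : ℕ} (hd : IsMetric d) : IsMetric (dL1 (N := N) d) where
  self_eq_zero x := Finset.sum_eq_zero fun _ _ => hd.self_eq_zero _
  eq_of_eq_zero x y h := funext fun i => hd.eq_of_eq_zero _ _
    ((Finset.sum_eq_zero_iff_of_nonneg fun _ _ => hd.nonneg _ _).1 h i (Finset.mem_univ i))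
  symm x y := Finset.sum_congr rfl fun i _ => hd.symm _ _
  triangle x y z := by
    simp only [GibbsSampling.dL1, ← Finset.sum_add_distrib]
    exact Finset.sum_le_sum fun i _ => hd.triangle _ _ _

lemma IsMetric.ofReal_dL1 {N : ℕ} (hd : IsMetric d) (x y : Fin N → α) :
    ENNReal.ofReal (GibbsSampling.dL1 d x y) = ∑ i, ENNReal.ofReal (d (x i) (y i)) :=
  ENNReal.ofReal_sum_of_nonneg fun _ _ => hd.nonneg _ _

/-- A semi-metric on configurations is bounded coordinatewise once it is so on pairs of
configurations differing at a single coordinate. -/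
lemma le_sum_of_differsOnlyAt {N : ℕ} (F : (Fin N → α) → (Fin N → α) → ℝ≥0∞)
    (h0 : ∀ x, F x x = 0) (htri : ∀ x y z, F x z ≤ F x y + F y z) (b : Fin N → α → α → ℝ≥0∞)
    (hF : ∀ j x y, DiffersOnlyAt j x y → F x y ≤ b j (x j) (y j)) (x y : Fin N → α) :
    F x y ≤ ∑ j, b j (x j) (y j) := by
  classical
  -- Interpolation: `s.piecewise y x` has already moved from `x` to `y` on `s`; adding `a` to `s`
  -- changes at most the coordinate `a`.
  have key : ∀ s : Finset (Fin N), F x (s.piecewise y x) ≤ ∑ j ∈ s, b j (x j) (y j) := by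
    intro s
    induction s using Finset.induction_on with
    | empty => simp [h0]
    | insert a s ha ih =>
      rw [Finset.sum_insert ha, Finset.piecewise_insert, add_comm]
      by_cases hxy : x a = y a
      · have : Function.update (s.piecewise y x) a (y a) = s.piecewise y x := by
          rw [← hxy]
          convert! Function.update_eq_self a (s.piecewise y x) using 2
          simp [ha]
        rw [this]
        exact ih.trans le_self_add
      · refine (htri _ (s.piecewise y x) _).trans (add_le_add ih ?_)
        have hD : DiffersOnlyAt a (s.piecewise y x)
            (Function.update (s.piecewise y x) a (y a)) :=
          ⟨fun k hk => by rw [Function.update_of_ne hk], by simpa [ha] using hxy⟩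
        simpa [ha] using hF a _ _ hD
  simpa using key Finset.univ

/-- The bound given by a Lipschitz coefficient in one coordinate. -/
lemma le_coeff_mul {N : ℕ} (hd : IsMetric d) (F : (Fin N → α) → (Fin N → α) → ℝ≥0∞)
    {j : Fin N} {x y : Fin N → α} (h : DiffersOnlyAt j x y) :
    F x y ≤ (⨆ (x : Fin N → α) (y : Fin N → α) (_ : DiffersOnlyAt j x y),
      F x y / ENNReal.ofReal (d (x j) (y j))) * ENNReal.ofReal (d (x j) (y j)) := by
  rw [← ENNReal.div_le_iff (by simpa using hd.pos h.2) ENNReal.ofReal_ne_top]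
  exact le_iSup_of_le x (le_iSup_of_le y (le_iSup_of_le h le_rfl))

lemma ofReal_abs_sub_le_sum_coordLip {N : ℕ} (hd : IsMetric d) (f : (Fin N → α) → ℝ)
    (x y : Fin N → α) :
    ENNReal.ofReal |f x - f y| ≤ ∑ j, coordLip d f j * ENNReal.ofReal (d (x j) (y j)) := by
  refine le_sum_of_differsOnlyAt (fun x y => ENNReal.ofReal |f x - f y|) (by simp)
    (fun x y z => ?_) (fun j a b => coordLip d f j * ENNReal.ofReal (d a b))
    (fun j x y h => le_coeff_mul hd (fun x y => ENNReal.ofReal |f x - f y|) h) x y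
  rw [← ENNReal.ofReal_add (abs_nonneg _) (abs_nonneg _)]
  exact ENNReal.ofReal_le_ofReal (abs_sub_le _ _ _)

end Metric

/-! ### Transport distance: triangle inequality, convexity, separation. -/

section Wasserstein

lemma IsCoupling.isProbabilityMeasure {α : Type*} [MeasurableSpace α] {π : Measure (α × α)}
    {ν₁ ν₂ : Measure α} [IsProbabilityMeasure ν₁] (h : IsCoupling π ν₁ ν₂) :
    IsProbabilityMeasure π := by
  have : IsProbabilityMeasure (π.map Prod.fst) := by rw [h.1]; infer_instance
  exact Measure.isProbabilityMeasure_of_map Prod.fst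

lemma isCoupling_prod {α : Type*} [MeasurableSpace α] (ν₁ ν₂ : Measure α)
    [IsProbabilityMeasure ν₁] [IsProbabilityMeasure ν₂] : IsCoupling (ν₁.prod ν₂) ν₁ ν₂ := by
  constructor
  · simp [Measure.map_fst_prod]
  · simp [Measure.map_snd_prod]

lemma wasserstein_le {α : Type*} [MeasurableSpace α] (d : α → α → ℝ) {π : Measure (α × α)}
    {ν₁ ν₂ : Measure α} (h : IsCoupling π ν₁ ν₂) :
    wasserstein d ν₁ ν₂ ≤ ∫⁻ z, ENNReal.ofReal (d z.1 z.2) ∂π :=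
  iInf₂_le π h

lemma wasserstein_self {E : Type*} [MeasurableSpace E] {d : E → E → ℝ} (hd : IsMetric d)
    (hdm : Measurable fun p : E × E => d p.1 p.2) (ν : Measure E) : wasserstein d ν ν = 0 := by
  have hm : Measurable fun x : E => (x, x) := by fun_prop
  refine le_antisymm ((wasserstein_le d (π := ν.map fun x => (x, x)) ⟨?_, ?_⟩).trans ?_) zero_le
  · rw [Measure.map_map measurable_fst hm]; exact Measure.map_id
  · rw [Measure.map_map measurable_snd hm]; exact Measure.map_id
  · rw [lintegral_map hdm.ennreal_ofReal hm]
    simp [hd.self_eq_zero]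

variable {E : Type*} [TopologicalSpace E] [PolishSpace E] [MeasurableSpace E] [BorelSpace E]
  {d : E → E → ℝ}

/-- Both couplings are disintegrated over their common marginal `ν₂` and glued conditionally
independently; the outer coordinates then couple `ν₁` and `ν₃`. -/
lemma wasserstein_triangle (hd : IsMetric d) (hdm : Measurable fun p : E × E => d p.1 p.2)
    (ν₁ ν₂ ν₃ : Measure E) [IsProbabilityMeasure ν₁] [IsProbabilityMeasure ν₂]
    [IsProbabilityMeasure ν₃] :
    wasserstein d ν₁ ν₃ ≤ wasserstein d ν₁ ν₂ + wasserstein d ν₂ ν₃ := by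
  have : Nonempty E := nonempty_of_isProbabilityMeasure ν₁
  rw [wasserstein.eq_1 d ν₁ ν₂, wasserstein.eq_1 d ν₂ ν₃]
  simp_rw [ENNReal.iInf_add, ENNReal.add_iInf]
  refine le_iInf fun π => le_iInf fun hπ => le_iInf fun σ => le_iInf fun hσ => ?_
  have := hπ.isProbabilityMeasure
  have := hσ.isProbabilityMeasure
  have hsw : IsProbabilityMeasure (π.map Prod.swap) :=
    Measure.isProbabilityMeasure_map measurable_swap.aemeasurable
  let K := (π.map Prod.swap).condKernel
  let L := σ.condKernel
  have hK : ν₂ ⊗ₘ K = π.map Prod.swap := by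
    have h := (π.map Prod.swap).disintegrate K
    rwa [Measure.fst, Measure.map_map measurable_fst measurable_swap,
      show Prod.fst ∘ Prod.swap = (Prod.snd : E × E → E) from rfl, hπ.2] at h
  have hL : ν₂ ⊗ₘ L = σ := by
    have h := σ.disintegrate L
    rwa [Measure.fst, hσ.1] at h
  let m : Measure (E × (E × E)) := ν₂ ⊗ₘ (K ×ₖ L)
  have hm₁ : m.map (fun p => (p.1, p.2.1)) = π.map Prod.swap := by
    have : K = (K ×ₖ L).map Prod.fst := by rw [← Kernel.fst_eq, Kernel.fst_prod]
    rw [← hK]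
    conv_rhs => rw [this, Measure.compProd_map measurable_fst]
    rfl
  have hm₂ : m.map (fun p => (p.1, p.2.2)) = σ := by
    have : L = (K ×ₖ L).map Prod.snd := by rw [← Kernel.snd_eq, Kernel.snd_prod]
    rw [← hL]
    conv_rhs => rw [this, Measure.compProd_map measurable_snd]
    rfl
  have hf₁ : Measurable fun p : E × (E × E) => (p.1, p.2.1) := by fun_prop
  have hf₂ : Measurable fun p : E × (E × E) => (p.1, p.2.2) := by fun_prop
  have hc : IsCoupling (m.map Prod.snd) ν₁ ν₃ := by
    constructor
    · rw [← hπ.1, Measure.map_map measurable_fst measurable_snd]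
      have := congrArg (Measure.map Prod.snd) hm₁
      rw [Measure.map_map measurable_snd hf₁, Measure.map_map measurable_snd measurable_swap]
        at this
      exact this
    · rw [← hσ.2, Measure.map_map measurable_snd measurable_snd, ← hm₂,
        Measure.map_map measurable_snd hf₂]
      rfl
  have hdo := hdm.ennreal_ofReal
  have e₁ : ∫⁻ z, ENNReal.ofReal (d z.1 z.2) ∂π = ∫⁻ p, ENNReal.ofReal (d p.2.1 p.1) ∂m := by
    have h1 : ∫⁻ z, ENNReal.ofReal (d z.2 z.1) ∂(π.map Prod.swap) =
        ∫⁻ z, ENNReal.ofReal (d z.1 z.2) ∂π :=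
      lintegral_map (hdo.comp measurable_swap) measurable_swap
    rw [← h1, ← hm₁]
    exact lintegral_map (hdo.comp measurable_swap) hf₁
  have e₂ : ∫⁻ z, ENNReal.ofReal (d z.1 z.2) ∂σ = ∫⁻ p, ENNReal.ofReal (d p.1 p.2.2) ∂m := by
    rw [← hm₂]
    exact lintegral_map hdo hf₂
  have hm : Measurable fun p : E × (E × E) => ENNReal.ofReal (d p.1 p.2.2) := hdo.comp hf₂
  refine (wasserstein_le d hc).trans ?_
  rw [lintegral_map hdo measurable_snd, e₁, e₂, ← lintegral_add_right _ hm]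
  exact lintegral_mono fun p => hd.ofReal_triangle _ _ _

/-- The pointwise optimal couplings of two kernels can be glued together. -/
lemma exists_glued_coupling_of_wasserstein_le {Z : Type*} [TopologicalSpace Z] [PolishSpace Z]
    [MeasurableSpace Z] [BorelSpace Z] (π : Measure Z) [IsProbabilityMeasure π]
    (κ₁ κ₂ : Kernel Z E) [IsMarkovKernel κ₁] [IsMarkovKernel κ₂]
    (hlsc : LowerSemicontinuous fun p : E × E => d p.1 p.2) (hd0 : ∀ x y, 0 ≤ d x y)
    {g : Z → ℝ≥0} (hg : Measurable g) (h : ∀ z, wasserstein d (κ₁ z) (κ₂ z) ≤ g z) :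
    ∃ ρ : Measure (Z × (E × E)), IsProbabilityMeasure ρ ∧
      ρ.map (fun p => (p.1, p.2.1)) = π ⊗ₘ κ₁ ∧ ρ.map (fun p => (p.1, p.2.2)) = π ⊗ₘ κ₂ ∧
      ∫⁻ p, ENNReal.ofReal (d p.2.1 p.2.2) ∂ρ ≤ ∫⁻ z, g z ∂π := by
  refine exists_glued_coupling π κ₁ κ₂ hlsc (fun p => hd0 _ _) hg fun z ε hε => ?_
  have hlt : wasserstein d (κ₁ z) (κ₂ z) < g z + ε :=
    (h z).trans_lt (ENNReal.lt_add_right ENNReal.coe_ne_top (by simpa using hε.ne'))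
  obtain ⟨q, hq⟩ := iInf_lt_iff.1 hlt
  obtain ⟨hq, hlt⟩ := iInf_lt_iff.1 hq
  exact ⟨q, hq, hlt.le⟩

/-- The Wasserstein cost is convex: it is at most the mean cost of the conditional laws. -/
lemma exists_coupling_comp_le {Z : Type*} [TopologicalSpace Z] [PolishSpace Z]
    [MeasurableSpace Z] [BorelSpace Z] (π : Measure Z) [IsProbabilityMeasure π]
    (κ₁ κ₂ : Kernel Z E) [IsMarkovKernel κ₁] [IsMarkovKernel κ₂]
    (hlsc : LowerSemicontinuous fun p : E × E => d p.1 p.2) (hd0 : ∀ x y, 0 ≤ d x y)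
    {g : Z → ℝ≥0} (hg : Measurable g) (h : ∀ z, wasserstein d (κ₁ z) (κ₂ z) ≤ g z) :
    ∃ q : Measure (E × E), IsCoupling q (κ₁ ∘ₘ π) (κ₂ ∘ₘ π) ∧
      ∫⁻ p, ENNReal.ofReal (d p.1 p.2) ∂q ≤ ∫⁻ z, g z ∂π := by
  obtain ⟨ρ, -, h₁, h₂, hρ⟩ :=
    exists_glued_coupling_of_wasserstein_le π κ₁ κ₂ hlsc hd0 hg h
  refine ⟨ρ.map Prod.snd, ⟨?_, ?_⟩, ?_⟩
  · rw [← Measure.snd_compProd, ← h₁, Measure.snd, Measure.map_map measurable_snd (by fun_prop),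
      Measure.map_map measurable_fst measurable_snd]
    rfl
  · rw [← Measure.snd_compProd, ← h₂, Measure.snd, Measure.map_map measurable_snd measurable_snd,
      Measure.map_map measurable_snd (by fun_prop)]
    rfl
  · rwa [lintegral_map hlsc.measurable.ennreal_ofReal measurable_snd]

/-- Probability measures at zero transport distance are equal. -/
lemma eq_of_wasserstein_eq_zero (hlsc : LowerSemicontinuous fun p : E × E => d p.1 p.2)
    (hd0 : ∀ x y, 0 ≤ d x y) (hd : ∀ x y, d x y = 0 → x = y) (ν₁ ν₂ : Measure E)
    [IsProbabilityMeasure ν₁] [IsProbabilityMeasure ν₂] (h : wasserstein d ν₁ ν₂ = 0) :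
    ν₁ = ν₂ := by
  -- Over a Dirac base, gluing turns an infimum equal to zero into a coupling of cost exactly zero;
  -- such a coupling lives on the diagonal.
  obtain ⟨q, hq, hq0⟩ := exists_coupling_comp_le (Measure.dirac (0 : ℝ)) (Kernel.const ℝ ν₁)
    (Kernel.const ℝ ν₂) hlsc hd0 (g := fun _ => 0) measurable_const (fun _ => by simp [h])
  simp only [Measure.const_comp, measure_univ, one_smul, ENNReal.coe_zero, lintegral_zero,
    nonpos_iff_eq_zero] at hq hq0
  rw [lintegral_eq_zero_iff hlsc.measurable.ennreal_ofReal] at hq0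
  rw [← hq.1, ← hq.2]
  refine Measure.map_congr ?_
  filter_upwards [hq0] with p hp
  exact hd _ _ (le_antisymm (ENNReal.ofReal_eq_zero.1 hp) (hd0 _ _))

end Wasserstein

/-! ### The Gibbs kernel and invariance of the target. -/

section GibbsKernel

variable {E : Type*} [MeasurableSpace E] {N : ℕ}
  (κ : ∀ i : Fin N, Kernel ({j : Fin N // j ≠ i} → E) E) [∀ i, IsMarkovKernel (κ i)]

instance (i : Fin N) : IsMarkovKernel (gibbsStep κ i) :=
  Kernel.IsMarkovKernel.map _ (measurable_updateCoord i)

/-- The kernel `K` followed by the updates of the coordinates in the list `l`. -/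
noncomputable def sweep {E : Type*} [MeasurableSpace E] {N : ℕ}
    (κ : ∀ i : Fin N, Kernel ({j : Fin N // j ≠ i} → E) E) (l : List (Fin N))
    (K : Kernel (Fin N → E) (Fin N → E)) : Kernel (Fin N → E) (Fin N → E) :=
  l.foldl (fun K i => gibbsStep κ i ∘ₖ K) K

lemma isMarkovKernel_sweep (l : List (Fin N)) (K : Kernel (Fin N → E) (Fin N → E))
    [IsMarkovKernel K] : IsMarkovKernel (sweep κ l K) := by
  induction l generalizing K with
  | nil => assumption
  | cons i l ih => exact ih (gibbsStep κ i ∘ₖ K)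

instance : IsMarkovKernel (gibbsKernel κ) :=
  isMarkovKernel_sweep κ (List.finRange N) Kernel.id

lemma isMarkovKernel_pow {α : Type*} [MeasurableSpace α] (P : Kernel α α) [IsMarkovKernel P]
    (k : ℕ) : IsMarkovKernel (P ^ k) := by
  induction k with
  | zero => exact (inferInstance : IsMarkovKernel (Kernel.id : Kernel α α))
  | succ k ih =>
    rw [pow_succ]
    exact (inferInstance : IsMarkovKernel ((P ^ k) ∘ₖ P))

lemma pow_succ_comp {α : Type*} [MeasurableSpace α] (P : Kernel α α) (k : ℕ) (ν : Measure α) :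
    ⇑(P ^ (k + 1)) ∘ₘ ν = P ∘ₘ (⇑(P ^ k) ∘ₘ ν) := by
  rw [Measure.comp_assoc, pow_succ']
  rfl

lemma pow_zero_comp {α : Type*} [MeasurableSpace α] (P : Kernel α α) (ν : Measure α) :
    ⇑(P ^ 0) ∘ₘ ν = ν := by
  rw [pow_zero]
  exact Measure.id_comp

lemma gibbsStep_apply_set (i : Fin N) (x : Fin N → E) {s : Set (Fin N → E)}
    (hs : MeasurableSet s) :
    gibbsStep κ i x s = κ i (offCoord i x) (Function.update x i ⁻¹' s) := by
  have hm : Measurable (Function.update x i) :=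
    (measurable_updateCoord i).comp (measurable_prodMk_left (x := x))
  rw [gibbsStep_apply, Measure.map_apply hm hs]

/-- Resampling the coordinate `i` of a random configuration `p z`, jointly with `z`. -/
lemma map_update_compProd {Z : Type*} [MeasurableSpace Z] (π : Measure Z) [SFinite π]
    (i : Fin N) {p : Z → Fin N → E} (hp : Measurable p) :
    (π ⊗ₘ (κ i).comap (fun z => offCoord i (p z)) ((measurable_offCoord i).comp hp)).map
      (fun q => Function.update (p q.1) i q.2) = gibbsStep κ i ∘ₘ π.map p := by
  have hv : Measurable fun q : Z × E => Function.update (p q.1) i q.2 :=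
    (measurable_updateCoord (E := E) i).comp
      (by fun_prop : Measurable fun q : Z × E => (p q.1, q.2))
  ext s hs
  rw [Measure.map_apply hv hs, Measure.compProd_apply (hv hs),
    Measure.bind_apply hs (Kernel.aemeasurable _),
    lintegral_map (Kernel.measurable_coe _ hs) hp]
  exact lintegral_congr fun z => (gibbsStep_apply_set κ i (p z) hs).symm

/-- The one-coordinate updates leave the target measure invariant. -/
lemma gibbsStep_comp_eq (i : Fin N) (μ : Measure (Fin N → E)) [IsProbabilityMeasure μ]
    (h : HasCondDistrib (fun x : Fin N → E => x i) (offCoord i) (κ i) μ) :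
    gibbsStep κ i ∘ₘ μ = μ := by
  -- `G` reassembles a configuration, so an update of `μ` is the image under `G` of the law of the
  -- other coordinates followed by `κ i`. By the conditional distribution property that joint law is
  -- the one of `(offCoord i x, x i)`, which `G` sends back to `μ`.
  let G : ({j : Fin N // j ≠ i} → E) × E → Fin N → E := fun p j =>
    if hj : j = i then p.2 else p.1 ⟨j, hj⟩
  have hG : Measurable G := measurable_pi_lambda _ fun j => by
    by_cases hj : j = i
    · simpa [G, hj] using measurable_snd
    · simp only [G, hj, dite_false]
      fun_prop
  have hGu : ∀ x u, G (offCoord i x, u) = Function.update x i u := fun x u => by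
    ext j
    by_cases hj : j = i
    · subst hj; simp [G]
    · simp [G, hj, offCoord]
  have hoff := measurable_offCoord (E := E) i
  have hmap : μ.map (fun x => (offCoord i x, x i)) = μ.map (offCoord i) ⊗ₘ κ i := h.map_eq
  ext s hs
  have hmeas : Measurable fun w => κ i w (Prod.mk w ⁻¹' (G ⁻¹' s)) :=
    Kernel.measurable_kernel_prodMk_left (hG hs)
  have : IsProbabilityMeasure (μ.map (offCoord i)) :=
    Measure.isProbabilityMeasure_map hoff.aemeasurable
  calc (gibbsStep κ i ∘ₘ μ) s
      = ∫⁻ x, κ i (offCoord i x) (Prod.mk (offCoord i x) ⁻¹' (G ⁻¹' s)) ∂μ := by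
        rw [Measure.bind_apply hs (Kernel.aemeasurable _)]
        refine lintegral_congr fun x => ?_
        rw [gibbsStep_apply_set κ i x hs]
        congr 1
        ext u
        simp [hGu]
    _ = (μ.map (offCoord i) ⊗ₘ κ i) (G ⁻¹' s) := by
        rw [Measure.compProd_apply (hG hs), lintegral_map hmeas hoff]
    _ = μ s := by
        rw [← hmap, Measure.map_apply (hoff.prodMk (measurable_pi_apply i)) (hG hs)]
        congr 1
        ext x
        simp [hGu]

lemma gibbsKernel_comp_eq (μ : Measure (Fin N → E)) [IsProbabilityMeasure μ]
    (h : ∀ i, HasCondDistrib (fun x : Fin N → E => x i) (offCoord i) (κ i) μ) :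
    gibbsKernel κ ∘ₘ μ = μ := by
  have key : ∀ (l : List (Fin N)) (K : Kernel (Fin N → E) (Fin N → E)), K ∘ₘ μ = μ →
      sweep κ l K ∘ₘ μ = μ := by
    intro l
    induction l with
    | nil => exact fun K hK => hK
    | cons i l ih =>
      intro K hK
      refine ih (gibbsStep κ i ∘ₖ K) ?_
      rw [← Measure.comp_assoc, hK, gibbsStep_comp_eq κ i μ (h i)]
  exact key (List.finRange N) Kernel.id Measure.id_comp

end GibbsKernel

/-! ### Contraction of the coupled chain. -/

section CoupledChain

/-- The mean distance `𝔼 d(Z^j(1), Z^j(2))` of the `j`-th coordinates under a coupling. -/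
noncomputable def coordCost {E : Type*} [MeasurableSpace E] {N : ℕ} (d : E → E → ℝ)
    (π : Measure ((Fin N → E) × (Fin N → E))) (j : Fin N) : ℝ≥0∞ :=
  ∫⁻ z, ENNReal.ofReal (d (z.1 j) (z.2 j)) ∂π

lemma measurable_coordDist {E : Type*} [MeasurableSpace E] {N : ℕ} {d : E → E → ℝ}
    (hdm : Measurable fun p : E × E => d p.1 p.2) (j : Fin N) :
    Measurable fun z : (Fin N → E) × (Fin N → E) => ENNReal.ofReal (d (z.1 j) (z.2 j)) :=
  hdm.ennreal_ofReal.comp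
    (by fun_prop : Measurable fun z : (Fin N → E) × (Fin N → E) => (z.1 j, z.2 j))

lemma sum_dobrushinCoeff_le {E : Type*} [MeasurableSpace E] {N : ℕ} (d : E → E → ℝ)
    (κ : ∀ i : Fin N, Kernel ({j : Fin N // j ≠ i} → E) E) (i : Fin N) :
    ∑ j, dobrushinCoeff d κ i j ≤ dobrushinNorm d κ :=
  le_iSup (fun i => ∑ j, dobrushinCoeff d κ i j) i

variable {E : Type*} [TopologicalSpace E] [PolishSpace E] [MeasurableSpace E] [BorelSpace E]
  {d : E → E → ℝ} {N : ℕ}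
  (κ : ∀ i : Fin N, Kernel ({j : Fin N // j ≠ i} → E) E) [∀ i, IsMarkovKernel (κ i)]

/-- The coefficients `c_ij` only see pairs differing at one coordinate; the triangle inequality for
transport distance extends the bound to all pairs. -/
lemma wasserstein_offCoord_le (hd : IsMetric d) (hdm : Measurable fun p : E × E => d p.1 p.2)
    (i : Fin N) (x y : Fin N → E) :
    wasserstein d (κ i (offCoord i x)) (κ i (offCoord i y)) ≤
      ∑ j, dobrushinCoeff d κ i j * ENNReal.ofReal (d (x j) (y j)) :=
  le_sum_of_differsOnlyAt
    (fun x y => wasserstein d (κ i (offCoord i x)) (κ i (offCoord i y)))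
    (fun _ => wasserstein_self hd hdm _) (fun _ _ _ => wasserstein_triangle hd hdm _ _ _)
    (fun j a b => dobrushinCoeff d κ i j * ENNReal.ofReal (d a b))
    (fun _ _ _ h => le_coeff_mul hd
      (fun x y => wasserstein d (κ i (offCoord i x)) (κ i (offCoord i y))) h) x y

/-- Updating the coordinate `i` of both components of a coupling by optimally coupled values. -/
lemma exists_coupling_gibbsStep (hd : IsMetric d)
    (hlsc : LowerSemicontinuous fun p : E × E => d p.1 p.2) (i : Fin N)
    (hC : ∀ j, dobrushinCoeff d κ i j ≠ ∞) {ν₁ ν₂ : Measure (Fin N → E)}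
    [IsProbabilityMeasure ν₁] [IsProbabilityMeasure ν₂]
    {π : Measure ((Fin N → E) × (Fin N → E))} (hπ : IsCoupling π ν₁ ν₂) :
    ∃ π' : Measure ((Fin N → E) × (Fin N → E)),
      IsCoupling π' (gibbsStep κ i ∘ₘ ν₁) (gibbsStep κ i ∘ₘ ν₂) ∧
      (∀ j, j ≠ i → coordCost d π' j = coordCost d π j) ∧
      coordCost d π' i ≤ ∑ j, dobrushinCoeff d κ i j * coordCost d π j := by
  have hdm := hlsc.measurable
  have := hπ.isProbabilityMeasure
  let κ₁ : Kernel ((Fin N → E) × (Fin N → E)) E :=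
    (κ i).comap (fun z => offCoord i z.1) ((measurable_offCoord i).comp measurable_fst)
  let κ₂ : Kernel ((Fin N → E) × (Fin N → E)) E :=
    (κ i).comap (fun z => offCoord i z.2) ((measurable_offCoord i).comp measurable_snd)
  -- An explicit measurable bound replaces the transport distance itself, so measurability of the
  -- latter in `z` is not needed. Finiteness of `c_ij` makes `toNNReal` lossless.
  let g : (Fin N → E) × (Fin N → E) → ℝ≥0 := fun z =>
    ∑ j, (dobrushinCoeff d κ i j).toNNReal * (d (z.1 j) (z.2 j)).toNNReal
  have hgc : ∀ z, (g z : ℝ≥0∞) =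
      ∑ j, dobrushinCoeff d κ i j * ENNReal.ofReal (d (z.1 j) (z.2 j)) := fun z => by
    simp only [g, ENNReal.ofNNReal_finsetSum, ENNReal.coe_mul, ENNReal.coe_toNNReal (hC _)]
    rfl
  have hg : Measurable g := by
    have : Measurable fun z => (g z : ℝ≥0∞) := by
      simp only [hgc]
      exact Finset.measurable_sum _ fun j _ => (measurable_coordDist hdm j).const_mul _
    simpa using this.ennreal_toNNReal
  obtain ⟨ρ, hρp, h₁, h₂, hρ⟩ := exists_glued_coupling_of_wasserstein_le π κ₁ κ₂ hlsc hd.nonneg hg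
    fun z => (wasserstein_offCoord_le κ hd hdm i z.1 z.2).trans_eq (hgc z).symm
  have hρ_fst : ρ.map Prod.fst = π := by
    rw [← Measure.fst_compProd π κ₁, ← h₁, Measure.fst,
      Measure.map_map measurable_fst (by fun_prop)]
    rfl
  let u := fun p : ((Fin N → E) × (Fin N → E)) × (E × E) =>
    (Function.update p.1.1 i p.2.1, Function.update p.1.2 i p.2.2)
  have hupd := measurable_updateCoord (E := E) i
  have hu : Measurable u := (hupd.comp (by fun_prop :
      Measurable fun p : ((Fin N → E) × (Fin N → E)) × (E × E) => (p.1.1, p.2.1))).prodMk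
    (hupd.comp (by fun_prop :
      Measurable fun p : ((Fin N → E) × (Fin N → E)) × (E × E) => (p.1.2, p.2.2)))
  refine ⟨ρ.map u, ⟨?_, ?_⟩, fun j hj => ?_, ?_⟩
  · have hv : Measurable fun p : ((Fin N → E) × (Fin N → E)) × E =>
        Function.update p.1.1 i p.2 := hupd.comp (by fun_prop :
      Measurable fun p : ((Fin N → E) × (Fin N → E)) × E => (p.1.1, p.2))
    rw [← hπ.1, ← map_update_compProd κ π i measurable_fst, ← h₁, Measure.map_map hv (by fun_prop),
      Measure.map_map measurable_fst hu]
    rfl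
  · have hv : Measurable fun p : ((Fin N → E) × (Fin N → E)) × E =>
        Function.update p.1.2 i p.2 := hupd.comp (by fun_prop :
      Measurable fun p : ((Fin N → E) × (Fin N → E)) × E => (p.1.2, p.2))
    rw [← hπ.2, ← map_update_compProd κ π i measurable_snd, ← h₂, Measure.map_map hv (by fun_prop),
      Measure.map_map measurable_snd hu]
    rfl
  · rw [coordCost, coordCost, lintegral_map (measurable_coordDist hdm j) hu]
    conv_rhs => rw [← hρ_fst, lintegral_map (measurable_coordDist hdm j) measurable_fst]
    simp [u, Function.update_of_ne hj]
  · rw [coordCost, lintegral_map (measurable_coordDist hdm i) hu]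
    simp only [u, Function.update_self]
    refine hρ.trans_eq ?_
    simp only [hgc]
    rw [lintegral_finsetSum _ fun j _ => (measurable_coordDist hdm j).const_mul _]
    exact Finset.sum_congr rfl fun j _ => lintegral_const_mul _ (measurable_coordDist hdm j)

/-- Along a list of successive updates, a coupling contracts in the updated coordinates. -/
lemma exists_coupling_sweep (hd : IsMetric d)
    (hlsc : LowerSemicontinuous fun p : E × E => d p.1 p.2) (H1 : dobrushinNorm d κ < 1)
    {ν₁ ν₂ : Measure (Fin N → E)} [IsProbabilityMeasure ν₁] [IsProbabilityMeasure ν₂] (D : ℝ≥0∞)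
    (l : List (Fin N)) (K : Kernel (Fin N → E) (Fin N → E)) [IsMarkovKernel K]
    {π : Measure ((Fin N → E) × (Fin N → E))} (hπ : IsCoupling π (K ∘ₘ ν₁) (K ∘ₘ ν₂))
    (hD : ∀ j, coordCost d π j ≤ D) :
    ∃ π' : Measure ((Fin N → E) × (Fin N → E)),
      IsCoupling π' (sweep κ l K ∘ₘ ν₁) (sweep κ l K ∘ₘ ν₂) ∧
      ∀ j, (j ∈ l ∨ coordCost d π j ≤ dobrushinNorm d κ * D) →
        coordCost d π' j ≤ dobrushinNorm d κ * D := by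
  -- All costs stay at most `D` since `r ≤ 1`, so each later update still gains the factor `r`. The
  -- second alternative of the disjunction carries the coordinates already improved.
  induction l generalizing K π with
  | nil => exact ⟨π, hπ, fun j hj => by simpa using hj⟩
  | cons i l ih =>
    have hC : ∀ j, dobrushinCoeff d κ i j ≠ ∞ := fun j =>
      ((Finset.single_le_sum (fun _ _ => zero_le) (Finset.mem_univ j)).trans_lt
        ((sum_dobrushinCoeff_le d κ i).trans_lt (H1.trans ENNReal.one_lt_top))).ne
    obtain ⟨π₁, hπ₁, hne, hi⟩ := exists_coupling_gibbsStep κ hd hlsc i hC hπ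
    have hi' : coordCost d π₁ i ≤ dobrushinNorm d κ * D := calc
      _ ≤ ∑ j, dobrushinCoeff d κ i j * D :=
        hi.trans (Finset.sum_le_sum fun j _ => mul_le_mul_right (hD j) _)
      _ ≤ _ := by
        rw [← Finset.sum_mul]
        exact mul_le_mul_left (sum_dobrushinCoeff_le d κ i) _
    have hD₁ : ∀ j, coordCost d π₁ j ≤ D := fun j => by
      by_cases hj : j = i
      · subst hj
        exact hi'.trans (mul_le_of_le_one_left zero_le H1.le)
      · exact (hne j hj).trans_le (hD j)
    rw [Measure.comp_assoc, Measure.comp_assoc] at hπ₁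
    obtain ⟨π', hπ', hle⟩ := ih (gibbsStep κ i ∘ₖ K) hπ₁ hD₁
    refine ⟨π', hπ', fun j hj => hle j ?_⟩
    by_cases hji : j = i
    · subst hji
      exact Or.inr hi'
    · rw [hne j hji]
      simpa [hji] using hj

/-- The coupled Gibbs sampler: `k` sweeps contract the coordinatewise mean distances by `r ^ k`. -/
lemma exists_coupling_pow (hd : IsMetric d)
    (hlsc : LowerSemicontinuous fun p : E × E => d p.1 p.2) (H1 : dobrushinNorm d κ < 1)
    {ν₁ ν₂ : Measure (Fin N → E)} [IsProbabilityMeasure ν₁] [IsProbabilityMeasure ν₂]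
    {π : Measure ((Fin N → E) × (Fin N → E))} (hπ : IsCoupling π ν₁ ν₂) (k : ℕ) :
    ∃ π' : Measure ((Fin N → E) × (Fin N → E)),
      IsCoupling π' (⇑(gibbsKernel κ ^ k) ∘ₘ ν₁) (⇑(gibbsKernel κ ^ k) ∘ₘ ν₂) ∧
      ∀ j, coordCost d π' j ≤ dobrushinNorm d κ ^ k * ⨆ i, coordCost d π i := by
  induction k with
  | zero =>
    refine ⟨π, by rwa [pow_zero_comp, pow_zero_comp], fun j => ?_⟩
    rw [pow_zero, one_mul]
    exact le_iSup (coordCost d π) j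
  | succ k ih =>
    obtain ⟨π₁, hπ₁, hle⟩ := ih
    have := isMarkovKernel_pow (gibbsKernel κ) k
    -- One sweep with `D = r ^ k * ⨆ i, coordCost d π i`, started from the law after `k` sweeps;
    -- every coordinate belongs to `List.finRange N`.
    obtain ⟨π', hπ', hle'⟩ := exists_coupling_sweep κ hd hlsc H1
      (ν₁ := ⇑(gibbsKernel κ ^ k) ∘ₘ ν₁) (ν₂ := ⇑(gibbsKernel κ ^ k) ∘ₘ ν₂) _
      (List.finRange N) Kernel.id (by rwa [Measure.id_comp, Measure.id_comp]) hle
    refine ⟨π', by rwa [pow_succ_comp, pow_succ_comp], fun j => ?_⟩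
    rw [pow_succ', mul_assoc]
    exact hle' j (Or.inl (List.mem_finRange j))

end CoupledChain

/-! ### Propagation of first moments and integrability. -/

section Moments

variable {E : Type*} [MeasurableSpace E] {d : E → E → ℝ} {N : ℕ}
  (κ : ∀ i : Fin N, Kernel ({j : Fin N // j ≠ i} → E) E) [∀ i, IsMarkovKernel (κ i)]

lemma measurable_dL1 (hdm : Measurable fun p : E × E => d p.1 p.2) :
    Measurable fun z : (Fin N → E) × (Fin N → E) => dL1 d z.1 z.2 :=
  Finset.measurable_sum _ fun j _ => hdm.comp
    (by fun_prop : Measurable fun z : (Fin N → E) × (Fin N → E) => (z.1 j, z.2 j))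

/-- The function `d a` is 1-Lipschitz, so every coupling gives the bound. It transfers the moment of
`κ i` at `x₀` to the other configurations. -/
lemma lintegral_le_add_wasserstein (hd : IsMetric d)
    (hdm : Measurable fun p : E × E => d p.1 p.2) (a : E) (ν₁ ν₂ : Measure E) :
    ∫⁻ u, ENNReal.ofReal (d a u) ∂ν₂ ≤
      ∫⁻ u, ENNReal.ofReal (d a u) ∂ν₁ + wasserstein d ν₁ ν₂ := by
  have ha : Measurable fun u => ENNReal.ofReal (d a u) :=
    hdm.ennreal_ofReal.comp (measurable_prodMk_left (x := a))
  rw [wasserstein]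
  simp_rw [ENNReal.add_iInf]
  refine le_iInf₂ fun q hq => ?_
  rw [← hq.1, ← hq.2, lintegral_map ha measurable_fst, lintegral_map ha measurable_snd,
    ← lintegral_add_right _ hdm.ennreal_ofReal]
  exact lintegral_mono fun p => hd.ofReal_triangle _ _ _

lemma HasFiniteMoment.lintegral_lt_top (hd : IsMetric d) {ν : Measure E} [IsProbabilityMeasure ν]
    (h : HasFiniteMoment d ν) (a : E) : ∫⁻ u, ENNReal.ofReal (d a u) ∂ν < ∞ := by
  obtain ⟨x₀, hx₀⟩ := h
  refine (lintegral_mono fun u => hd.ofReal_triangle a x₀ u).trans_lt ?_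
  rw [lintegral_add_left measurable_const]
  simpa using hx₀

/-- One-coordinate updates preserve the finiteness of first moments. -/
lemma HasFiniteMoment.gibbsStep (hd : IsMetric d)
    (hdm : Measurable fun p : E × E => d p.1 p.2) (i : Fin N)
    (hmom : ∀ x : Fin N → E, HasFiniteMoment d (κ i (offCoord i x)))
    (hLip : ∃ L : ℝ≥0, ∀ x y : Fin N → E,
      wasserstein d (κ i (offCoord i x)) (κ i (offCoord i y)) ≤ L * ENNReal.ofReal (dL1 d x y))
    {ν : Measure (Fin N → E)} [IsProbabilityMeasure ν] (h : HasFiniteMoment (dL1 d) ν) :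
    HasFiniteMoment (dL1 d) (gibbsStep κ i ∘ₘ ν) := by
  obtain ⟨x₀, hx₀⟩ := h
  obtain ⟨L, hL⟩ := hLip
  refine ⟨x₀, ?_⟩
  have hm : Measurable fun y => ENNReal.ofReal (dL1 d x₀ y) :=
    ((measurable_dL1 hdm).comp (measurable_prodMk_left (x := x₀))).ennreal_ofReal
  have hi : Measurable fun u => ENNReal.ofReal (d (x₀ i) u) :=
    hdm.ennreal_ofReal.comp (measurable_prodMk_left (x := x₀ i))
  set M := ∫⁻ u, ENNReal.ofReal (d (x₀ i) u) ∂(κ i (offCoord i x₀))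
  have hM : M < ∞ := (hmom x₀).lintegral_lt_top hd (x₀ i)
  -- An update adds at most `d (x₀ i) u`, whose mean exceeds that at `x₀` by at most the Lipschitz
  -- term; the bound is thus affine in `dL1 d x₀ x`.
  have hstep : ∀ x, ∫⁻ y, ENNReal.ofReal (dL1 d x₀ y) ∂(GibbsSampling.gibbsStep κ i x) ≤
      ENNReal.ofReal (dL1 d x₀ x) + (M + L * ENNReal.ofReal (dL1 d x₀ x)) := fun x => by
    have hupd : Measurable (Function.update x i) :=
      (measurable_updateCoord i).comp (measurable_prodMk_left (x := x))
    rw [gibbsStep_apply, lintegral_map hm hupd]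
    calc ∫⁻ u, ENNReal.ofReal (dL1 d x₀ (Function.update x i u)) ∂(κ i (offCoord i x))
        ≤ ∫⁻ u, (ENNReal.ofReal (dL1 d x₀ x) + ENNReal.ofReal (d (x₀ i) u))
            ∂(κ i (offCoord i x)) := lintegral_mono fun u => by
          rw [hd.ofReal_dL1, hd.ofReal_dL1, ← Finset.add_sum_erase _ _ (Finset.mem_univ i),
            add_comm, Function.update_self]
          refine add_le_add ?_ le_rfl
          refine le_trans (Finset.sum_le_sum fun j hj => ?_)
            (Finset.sum_le_sum_of_subset (Finset.erase_subset i Finset.univ))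
          rw [Function.update_of_ne (Finset.ne_of_mem_erase hj)]
      _ = ENNReal.ofReal (dL1 d x₀ x) +
            ∫⁻ u, ENNReal.ofReal (d (x₀ i) u) ∂(κ i (offCoord i x)) := by
          rw [lintegral_add_left measurable_const]; simp
      _ ≤ _ := add_le_add le_rfl ((lintegral_le_add_wasserstein hd hdm _ _ _).trans
          (add_le_add le_rfl (hL x₀ x)))
  rw [Measure.lintegral_bind (Kernel.aemeasurable _) hm.aemeasurable]
  refine (lintegral_mono hstep).trans_lt ?_
  rw [lintegral_add_left hm, lintegral_add_left measurable_const, lintegral_const_mul _ hm]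
  simpa using ⟨hx₀, hM, ENNReal.mul_lt_top ENNReal.coe_lt_top hx₀⟩

lemma HasFiniteMoment.pow (hd : IsMetric d)
    (hdm : Measurable fun p : E × E => d p.1 p.2)
    (hmom : ∀ i (x : Fin N → E), HasFiniteMoment d (κ i (offCoord i x)))
    (hLip : ∀ i, ∃ L : ℝ≥0, ∀ x y : Fin N → E,
      wasserstein d (κ i (offCoord i x)) (κ i (offCoord i y)) ≤ L * ENNReal.ofReal (dL1 d x y))
    {ν : Measure (Fin N → E)} [IsProbabilityMeasure ν] (h : HasFiniteMoment (dL1 d) ν) (k : ℕ) :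
    HasFiniteMoment (dL1 d) (⇑(gibbsKernel κ ^ k) ∘ₘ ν) := by
  have key : ∀ (ν : Measure (Fin N → E)) [IsProbabilityMeasure ν] (l : List (Fin N))
      (K : Kernel (Fin N → E) (Fin N → E)) [IsMarkovKernel K],
      HasFiniteMoment (dL1 d) (K ∘ₘ ν) → HasFiniteMoment (dL1 d) (sweep κ l K ∘ₘ ν) := by
    intro ν _ l
    induction l with
    | nil => exact fun K _ hK => hK
    | cons i l ih =>
      intro K _ hK
      refine ih (GibbsSampling.gibbsStep κ i ∘ₖ K) ?_
      rw [← Measure.comp_assoc]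
      exact hK.gibbsStep κ hd hdm i (hmom i) (hLip i)
  induction k with
  | zero => rwa [pow_zero_comp]
  | succ k ih =>
    have := isMarkovKernel_pow (gibbsKernel κ) k
    rw [pow_succ_comp]
    exact key _ (List.finRange N) Kernel.id (by rwa [Measure.id_comp])

lemma HasFiniteMoment.integrable {α : Type*} [MeasurableSpace α] {ρ : α → α → ℝ}
    (hρ : IsMetric ρ) (hρm : Measurable fun p : α × α => ρ p.1 p.2) {f : α → ℝ}
    (hf : Measurable f) (hL : ∃ L : ℝ, ∀ x y, |f x - f y| ≤ L * ρ x y) {ν : Measure α}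
    [IsProbabilityMeasure ν] (h : HasFiniteMoment ρ ν) : Integrable f ν := by
  obtain ⟨x₀, hx₀⟩ := h
  obtain ⟨L, hL⟩ := hL
  have hi : Integrable (fun x => ρ x₀ x) ν :=
    ⟨(hρm.comp (measurable_prodMk_left (x := x₀))).aestronglyMeasurable, by
      rw [hasFiniteIntegral_iff_ofReal (ae_of_all _ fun x => hρ.nonneg x₀ x)]
      exact hx₀⟩
  refine ((integrable_const |f x₀|).add (hi.const_mul L)).mono' hf.aestronglyMeasurable
    (ae_of_all _ fun x => ?_)
  have h1 := hL x₀ x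
  rw [abs_sub_comm] at h1
  have h2 := abs_sub_abs_le_abs_sub (f x) (f x₀)
  simp only [Real.norm_eq_abs, Pi.add_apply]
  linarith

end Moments

/-! ### From couplings to convergence and uniqueness. -/

section Convergence

variable {E : Type*} [TopologicalSpace E] [PolishSpace E] [MeasurableSpace E] [BorelSpace E]
  {d : E → E → ℝ} {N : ℕ}
  (κ : ∀ i : Fin N, Kernel ({j : Fin N // j ≠ i} → E) E) [∀ i, IsMarkovKernel (κ i)]

/-- The difference of two means is controlled by the coordinatewise cost of any coupling. -/
lemma ofReal_abs_integral_sub_le {E : Type*} [MeasurableSpace E] {N : ℕ} {d : E → E → ℝ}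
    (hd : IsMetric d)
    (hdm : Measurable fun p : E × E => d p.1 p.2) {f : (Fin N → E) → ℝ} (hf : Measurable f)
    {ν₁ ν₂ : Measure (Fin N → E)} (h₁ : Integrable f ν₁) (h₂ : Integrable f ν₂)
    {π : Measure ((Fin N → E) × (Fin N → E))} (hπ : IsCoupling π ν₁ ν₂) :
    ENNReal.ofReal |∫ x, f x ∂ν₁ - ∫ x, f x ∂ν₂| ≤ ∑ j, coordLip d f j * coordCost d π j := by
  rw [← hπ.1] at h₁ ⊢
  rw [← hπ.2] at h₂ ⊢
  have i₁ : Integrable (fun z => f z.1) π := h₁.comp_measurable measurable_fst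
  have i₂ : Integrable (fun z => f z.2) π := h₂.comp_measurable measurable_snd
  rw [integral_map measurable_fst.aemeasurable hf.aestronglyMeasurable,
    integral_map measurable_snd.aemeasurable hf.aestronglyMeasurable, ← integral_sub i₁ i₂,
    ← Real.enorm_eq_ofReal_abs]
  refine (enorm_integral_le_lintegral_enorm _).trans ?_
  calc ∫⁻ z, ‖f z.1 - f z.2‖ₑ ∂π
      ≤ ∫⁻ z, ∑ j, coordLip d f j * ENNReal.ofReal (d (z.1 j) (z.2 j)) ∂π :=
        lintegral_mono fun z => by
          rw [Real.enorm_eq_ofReal_abs]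
          exact ofReal_abs_sub_le_sum_coordLip hd f z.1 z.2
    _ = _ := by
        rw [lintegral_finsetSum _ fun j _ => (measurable_coordDist hdm j).const_mul _]
        exact Finset.sum_congr rfl fun j _ => lintegral_const_mul _ (measurable_coordDist hdm j)

lemma wasserstein_dL1_le_sum {E : Type*} [MeasurableSpace E] {N : ℕ} {d : E → E → ℝ}
    (hd : IsMetric d) (hdm : Measurable fun p : E × E => d p.1 p.2)
    {ν₁ ν₂ : Measure (Fin N → E)} {π : Measure ((Fin N → E) × (Fin N → E))}
    (hπ : IsCoupling π ν₁ ν₂) :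
    wasserstein (dL1 d) ν₁ ν₂ ≤ ∑ j, coordCost d π j := by
  refine (wasserstein_le _ hπ).trans_eq ?_
  simp only [hd.ofReal_dL1]
  exact lintegral_finsetSum _ fun j _ => measurable_coordDist hdm j

lemma wasserstein_pow_le (hd : IsMetric d)
    (hlsc : LowerSemicontinuous fun p : E × E => d p.1 p.2) (H1 : dobrushinNorm d κ < 1)
    {ν₁ ν₂ : Measure (Fin N → E)} [IsProbabilityMeasure ν₁] [IsProbabilityMeasure ν₂]
    {π : Measure ((Fin N → E) × (Fin N → E))} (hπ : IsCoupling π ν₁ ν₂) (k : ℕ) :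
    wasserstein (dL1 d) (⇑(gibbsKernel κ ^ k) ∘ₘ ν₁) (⇑(gibbsKernel κ ^ k) ∘ₘ ν₂) ≤
      N * dobrushinNorm d κ ^ k * ⨆ i, coordCost d π i := by
  obtain ⟨π', hπ', hle⟩ := exists_coupling_pow κ hd hlsc H1 hπ k
  calc _ ≤ ∑ j, coordCost d π' j := wasserstein_dL1_le_sum hd hlsc.measurable hπ'
    _ ≤ ∑ _j : Fin N, dobrushinNorm d κ ^ k * ⨆ i, coordCost d π i :=
      Finset.sum_le_sum fun j _ => hle j
    _ = _ := by simp [mul_assoc]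

lemma pow_comp_eq {α : Type*} [MeasurableSpace α] {P : Kernel α α} {ν : Measure α}
    (h : P ∘ₘ ν = ν) (k : ℕ) : ⇑(P ^ k) ∘ₘ ν = ν := by
  induction k with
  | zero => exact pow_zero_comp P ν
  | succ k ih => rw [pow_succ_comp, ih, h]

lemma coordCost_dirac_prod {E : Type*} [MeasurableSpace E] {N : ℕ} {d : E → E → ℝ}
    (hdm : Measurable fun p : E × E => d p.1 p.2) (x : Fin N → E) (μ : Measure (Fin N → E))
    [SFinite μ] (i : Fin N) :
    coordCost d ((Measure.dirac x).prod μ) i = ∫⁻ y, ENNReal.ofReal (d (x i) (y i)) ∂μ := by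
  rw [coordCost, Measure.dirac_prod,
    lintegral_map (measurable_coordDist hdm i) (measurable_prodMk_left (x := x))]

/-- If the kernels `P n` converge pointwise to `μ` in transport distance, any probability measure
invariant for all of them is `μ`. -/
lemma eq_of_tendsto_wasserstein {α : Type*} [TopologicalSpace α] [PolishSpace α]
    [MeasurableSpace α] [BorelSpace α] {ρ : α → α → ℝ} (hρ : IsMetric ρ)
    (hlsc : LowerSemicontinuous fun p : α × α => ρ p.1 p.2) {μ ν : Measure α}
    [IsProbabilityMeasure μ] [IsProbabilityMeasure ν] (P : ℕ → Kernel α α)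
    [∀ n, IsMarkovKernel (P n)] (hP : ∀ n, P n ∘ₘ ν = ν) (g : ℕ → α → ℝ≥0∞)
    (hg : ∀ n, Measurable (g n)) (hPg : ∀ n x, wasserstein ρ (P n x) μ ≤ g n x)
    (hlim : ∀ x, Tendsto (fun n => g n x) atTop (𝓝 0)) : ν = μ := by
  -- `g n` need not be `ν`-integrable. Truncation supplies the dominating constant `1` and keeps
  -- lower semicontinuity and separation of points.
  let ρ' : α → α → ℝ := fun x y => min (ρ x y) 1
  have hlsc' : LowerSemicontinuous fun p : α × α => ρ' p.1 p.2 := hlsc.inf lowerSemicontinuous_const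
  have hρ'0 : ∀ x y, 0 ≤ ρ' x y := fun x y => le_min (hρ.nonneg x y) zero_le_one
  have hρ'1 : ∀ x y, ρ' x y = 0 → x = y := fun x y h => by
    refine hρ.eq_of_eq_zero x y ?_
    rcases min_choice (ρ x y) 1 with h1 | h1
    · rw [← h1]; exact h
    · simp only [ρ', h1, one_ne_zero] at h
  have hW : ∀ n x, wasserstein ρ' (P n x) μ ≤ min (g n x) 1 := fun n x => by
    refine le_min (le_trans ?_ (hPg n x)) ?_
    · exact iInf₂_mono fun q _ => lintegral_mono fun z =>
        ENNReal.ofReal_le_ofReal (min_le_left _ _)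
    · refine (wasserstein_le ρ' (isCoupling_prod (P n x) μ)).trans ?_
      refine (lintegral_mono (g := fun _ => 1) fun z => ?_).trans (by simp)
      exact (ENNReal.ofReal_le_ofReal (min_le_right _ _)).trans (by simp)
  have hfin : ∀ n x, min (g n x) 1 ≠ ∞ := fun n x =>
    ((min_le_right _ _).trans_lt ENNReal.one_lt_top).ne
  have hle : ∀ n, wasserstein ρ' ν μ ≤ ∫⁻ x, min (g n x) 1 ∂ν := fun n => by
    -- Convexity of the cost: `ν` is the `ν`-mixture of the laws `P n x`, and `μ` that of a constant
    -- kernel.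
    obtain ⟨q, hq, hq'⟩ := exists_coupling_comp_le ν (P n) (Kernel.const α μ) hlsc' hρ'0
      (g := fun x => (min (g n x) 1).toNNReal) ((hg n).min measurable_const).ennreal_toNNReal
      (fun x => by
        rw [ENNReal.coe_toNNReal (hfin n x)]
        exact hW n x)
    rw [hP, Measure.const_comp, measure_univ, one_smul] at hq
    refine (wasserstein_le ρ' hq).trans (hq'.trans_eq ?_)
    exact lintegral_congr fun x => ENNReal.coe_toNNReal (hfin n x)
  have h0 : Tendsto (fun n => ∫⁻ x, min (g n x) 1 ∂ν) atTop (𝓝 (∫⁻ _, 0 ∂ν)) := by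
    refine tendsto_lintegral_of_dominated_convergence (fun _ => 1)
      (fun n => (hg n).min measurable_const) (fun n => ae_of_all _ fun x => min_le_right _ _)
      (by simp) (ae_of_all _ fun x => ?_)
    simpa using (hlim x).min (tendsto_const_nhds (x := (1 : ℝ≥0∞)))
  rw [lintegral_zero] at h0
  exact eq_of_wasserstein_eq_zero hlsc' hρ'0 hρ'1 ν μ
    (le_antisymm (ge_of_tendsto' h0 hle) zero_le)

end Convergence

end GibbsSampling

/-! ### The convergence rate and its consequences. -/

theorem theorem2p3 {E : Type*} [TopologicalSpace E] [PolishSpace E] [MeasurableSpace E]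
    [BorelSpace E]
    -- the metric, lower semicontinuous for the topology of `E`
    (d : E → E → ℝ) (hd : GibbsSampling.IsMetric d)
    (hlsc : LowerSemicontinuous fun p : E × E => d p.1 p.2)
    {N : ℕ}
    -- the target measure, with a finite first moment
    (μ : Measure (Fin N → E)) [IsProbabilityMeasure μ]
    (hμ : ∃ x₀ : Fin N → E, ∀ i, ∫⁻ y, ENNReal.ofReal (d (y i) (x₀ i)) ∂μ < ∞)
    -- the given regular conditional distributions of `x^i` knowing `(x^j, j ≠ i)` under `μ`
    (κ : ∀ i : Fin N, Kernel ({j : Fin N // j ≠ i} → E) E) [∀ i, IsMarkovKernel (κ i)]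
    (hκ : ∀ i, HasCondDistrib (fun x : Fin N → E => x i) (GibbsSampling.offCoord i) (κ i) μ)
    (hmom : ∀ i (x : Fin N → E),
      GibbsSampling.HasFiniteMoment d (κ i (GibbsSampling.offCoord i x)))
    (hLip : ∀ i, ∃ L : ℝ≥0, ∀ x y : Fin N → E,
      GibbsSampling.wasserstein d (κ i (GibbsSampling.offCoord i x))
        (κ i (GibbsSampling.offCoord i y)) ≤ L * ENNReal.ofReal (GibbsSampling.dL1 d x y))
    -- Dobrushin's uniqueness condition
    (r : ℝ≥0∞) (hr : r = GibbsSampling.dobrushinNorm d κ) (H1 : r < 1)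
    -- the Gibbs sampler
    (P : Kernel (Fin N → E) (Fin N → E)) (hP : P = GibbsSampling.gibbsKernel κ) :
    -- (a)
    (∀ f : (Fin N → E) → ℝ, Measurable f →
      (∃ L : ℝ, ∀ x y, |f x - f y| ≤ L * GibbsSampling.dL1 d x y) →
      -- `νP^k f` is well defined for every initial law with a finite first moment
      (∀ ν : Measure (Fin N → E), IsProbabilityMeasure ν →
        GibbsSampling.HasFiniteMoment (GibbsSampling.dL1 d) ν →
        ∀ k : ℕ, 1 ≤ k → Integrable f (⇑(P ^ k) ∘ₘ ν)) ∧
      -- the estimate, for all initial laws for which `ν₁P^k f` and `ν₂P^k f` are defined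
      ∀ ν₁ ν₂ : Measure (Fin N → E), IsProbabilityMeasure ν₁ → IsProbabilityMeasure ν₂ →
        ∀ π : Measure ((Fin N → E) × (Fin N → E)), GibbsSampling.IsCoupling π ν₁ ν₂ →
        ∀ k : ℕ, 1 ≤ k → Integrable f (⇑(P ^ k) ∘ₘ ν₁) → Integrable f (⇑(P ^ k) ∘ₘ ν₂) →
          ENNReal.ofReal |∫ x, f x ∂(⇑(P ^ k) ∘ₘ ν₁) - ∫ x, f x ∂(⇑(P ^ k) ∘ₘ ν₂)| ≤
            r ^ k * (⨆ i, ∫⁻ z, ENNReal.ofReal (d (z.1 i) (z.2 i)) ∂π) *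
              ∑ i, GibbsSampling.coordLip d f i) ∧
    -- (b)
    (∀ ν : Measure (Fin N → E), IsProbabilityMeasure ν →
      ∀ π : Measure ((Fin N → E) × (Fin N → E)), GibbsSampling.IsCoupling π ν μ →
      ∀ k : ℕ, 1 ≤ k →
        GibbsSampling.wasserstein (GibbsSampling.dL1 d) (⇑(P ^ k) ∘ₘ ν) μ ≤
          N * r ^ k * ⨆ i, ∫⁻ z, ENNReal.ofReal (d (z.1 i) (z.2 i)) ∂π) ∧
    -- `μ` is the unique invariant probability measure
    (P.Invariant μ ∧
      ∀ ν : Measure (Fin N → E), IsProbabilityMeasure ν → P.Invariant ν → ν = μ) ∧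
    -- `P^k(x, ·)` converges to `μ` exponentially fast
    (∀ x : Fin N → E,
      (⨆ i, ∫⁻ y, ENNReal.ofReal (d (x i) (y i)) ∂μ) < ∞ ∧
      ∀ k : ℕ, 1 ≤ k →
        GibbsSampling.wasserstein (GibbsSampling.dL1 d) ((P ^ k) x) μ ≤
          N * r ^ k * ⨆ i, ∫⁻ y, ENNReal.ofReal (d (x i) (y i)) ∂μ) := by
  subst hr hP
  have hdm := hlsc.measurable
  have hlsc' : LowerSemicontinuous fun p : (Fin N → E) × (Fin N → E) =>
      GibbsSampling.dL1 d p.1 p.2 :=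
    lowerSemicontinuous_sum fun i _ => LowerSemicontinuous.comp hlsc
      (by fun_prop : Continuous fun p : (Fin N → E) × (Fin N → E) => (p.1 i, p.2 i))
  have hinv := GibbsSampling.gibbsKernel_comp_eq κ μ hκ
  have hb : ∀ ν : Measure (Fin N → E), IsProbabilityMeasure ν →
      ∀ π : Measure ((Fin N → E) × (Fin N → E)), GibbsSampling.IsCoupling π ν μ → ∀ k : ℕ,
        GibbsSampling.wasserstein (GibbsSampling.dL1 d)
          (⇑(GibbsSampling.gibbsKernel κ ^ k) ∘ₘ ν) μ ≤
          N * GibbsSampling.dobrushinNorm d κ ^ k *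
            ⨆ i, ∫⁻ z, ENNReal.ofReal (d (z.1 i) (z.2 i)) ∂π := by
    intro ν _ π hπ k
    have h := GibbsSampling.wasserstein_pow_le κ hd hlsc H1 hπ k
    rwa [GibbsSampling.pow_comp_eq hinv k] at h
  have hx : ∀ (x : Fin N → E) (k : ℕ), GibbsSampling.wasserstein (GibbsSampling.dL1 d)
      ((GibbsSampling.gibbsKernel κ ^ k) x) μ ≤ N * GibbsSampling.dobrushinNorm d κ ^ k *
        ⨆ i, ∫⁻ y, ENNReal.ofReal (d (x i) (y i)) ∂μ := by
    intro x k
    have h := hb (Measure.dirac x) inferInstance _ (GibbsSampling.isCoupling_prod _ μ) k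
    rw [Measure.dirac_bind (Kernel.measurable _)] at h
    refine h.trans_eq ?_
    congr 1
    exact iSup_congr fun i => GibbsSampling.coordCost_dirac_prod hdm x μ i
  have hfin : ∀ x : Fin N → E, (⨆ i, ∫⁻ y, ENNReal.ofReal (d (x i) (y i)) ∂μ) < ∞ := by
    intro x
    obtain ⟨x₀, hx₀⟩ := hμ
    -- The supremum is dominated by a finite sum, which also covers `N = 0`.
    refine lt_of_le_of_lt (iSup_le fun i => Finset.single_le_sum
      (f := fun i => ∫⁻ y, ENNReal.ofReal (d (x i) (y i)) ∂μ) (fun _ _ => zero_le)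
      (Finset.mem_univ i)) (ENNReal.sum_lt_top.2 fun i _ => ?_)
    refine (lintegral_mono fun y : Fin N → E => hd.ofReal_triangle (x i) (x₀ i) (y i)).trans_lt ?_
    rw [lintegral_add_left measurable_const]
    simp only [hd.symm (x₀ i)]
    simpa using hx₀ i
  refine ⟨fun f hf hfL => ⟨fun ν _ hν k _ => ?_, fun ν₁ ν₂ _ _ π hπ k _ h₁ h₂ => ?_⟩,
    fun ν hν π hπ k _ => hb ν hν π hπ k, ⟨hinv, fun ν _ hν => ?_⟩,
    fun x => ⟨hfin x, fun k _ => hx x k⟩⟩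
  · have := GibbsSampling.isMarkovKernel_pow (GibbsSampling.gibbsKernel κ) k
    exact (hν.pow κ hd hdm hmom hLip k).integrable hd.dL1 (GibbsSampling.measurable_dL1 hdm) hf hfL
  · obtain ⟨π', hπ', hle⟩ := GibbsSampling.exists_coupling_pow κ hd hlsc H1 hπ k
    refine (GibbsSampling.ofReal_abs_integral_sub_le hd hdm hf h₁ h₂ hπ').trans ?_
    rw [mul_comm, Finset.sum_mul]
    exact Finset.sum_le_sum fun j _ => mul_le_mul_right (hle j) _
  · have hP := GibbsSampling.isMarkovKernel_pow (GibbsSampling.gibbsKernel κ)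
    -- The bound `N r ^ k ⨆ i, ∫ d(x^i, y^i) μ(dy)` is measurable in `x` and tends to zero at each
    -- `x`, the supremum being finite there.
    refine GibbsSampling.eq_of_tendsto_wasserstein hd.dL1 hlsc'
      (fun k => GibbsSampling.gibbsKernel κ ^ k) (GibbsSampling.pow_comp_eq hν) _ (fun k => ?_)
      (fun k x => hx x k) (fun x => ?_)
    · refine (Measurable.iSup fun i => ?_).const_mul _
      exact (GibbsSampling.measurable_coordDist hdm i).lintegral_prod_right'
    · have h0 := ENNReal.Tendsto.mul_const (b := ⨆ i, ∫⁻ y, ENNReal.ofReal (d (x i) (y i)) ∂μ)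
        (ENNReal.Tendsto.const_mul (a := (N : ℝ≥0∞))
          (ENNReal.tendsto_pow_atTop_nhds_zero_of_lt_one H1) (Or.inr (ENNReal.natCast_ne_top N)))
        (Or.inr (hfin x).ne)
      simpa using h0
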